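/- Let $\mu$ be a non-atomic Borel probability measure on a standard Borel space $X$, and let $L^0(\mu,\mathbb T)$ be the group of $\mu$-classes of Borel functions from $X$ to the unit circle, with pointwise multiplication and the topology of convergence in measure. Let $S$ be the set of all non-empty finite sequences $\kappa=(\kappa(1)\le\dots\le\kappa(n))$ of non-zero integers, and write $|\kappa|=n$. For $\kappa\in S$ and $i\in\{1,2,\dots\}$ let $\lambda^i_\kappa$ be a finite Borel measure on $X^{|\kappa|}$ whose marginals are absolutely continuous with respect to $\mu$, such that $\lambda^i_\kappa(\{x: x_a=x_b\})=0$ for $a<b$, and $\lambda^j_\kappa\ll\lambda^i_\kappa$ for $i<j$. Let $\sigma(\kappa,\lambda^i_\kappa)$ be the unitary representation of $L^0(\mu,\mathbb T)$ on $L^2(\lambda^i_\kappa)$ in which $f$ acts as multiplication by $f^\kappa(x)=\prod_{a\le|\kappa|}f(x_a)^{\kappa(a)}$. Let $\Phi$ be a strongly continuous unitary representation of $L^0(\mu,\mathbb T)$ on a separable complex Hilbert space $H$ that is (unitarily equivalent to) $\bigoplus_{\kappa\in S,\,i\ge1}\sigma(\kappa,\lambda^i_\kappa)$. For a unitary operator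 $u$ on $H$ the spectral measure of $h\in H$ is the finite Borel measure $\sigma_h$ on $\mathbb T$ with $\langle u^kh,h\rangle=\int z^k\,d\sigma_h$ for all $k\in\mathbb Z$; the maximal spectral type $\sigma_u$ is a spectral measure of some vector with respect to which the spectral measures of all vectors are absolutely continuous (unique up to mutual absolute continuity). Let $K$ be either the set of positive integers or the set of non-zero integers. The following are equivalent. 1. (The DL-condition with coefficients in $K$; for $K=\mathbb Z^+$ this is the DL-condition.) There is a dense $G_\delta$ set $G\subseteq L^0(\mu,\mathbb T)$ such that for every $f\in G$, all $l,l'\ge1$, and all tuples $(k(1),\dots,k(l))$ and $(k'(1),\dots,k'(l'))$ of elements of $K$ that are not rearrangements of each other, $$\sigma_{\Phi(f)^{k(1)}}*\cdots*\sigma_{\Phi(f)^{k(l)}}\ \perp\ \sigma_{\Phi(f)^{k'(1)}}*\cdots*\sigma_{\Phi(f)^{k'(l')}}.$$ 2. (The orthogonality relations with coefficients in $K$.) For all $l,l'\ge1$, all $\kappa_1,\dots,\kappa_l,\kappa'_1,\dots,\kappa'_{l'}\in S$ with $|\kappa_1|+\dots+|\kappa_l|=|\kappa'_1|+\dots+|\kappa'_{l'}|=t$,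 and every permutation $r$ of $\{1,\dots,t\}$, $$\lambda^1_{\kappa_1}\times\cdots\times\lambda^1_{\kappa_l}\ \perp\ r\big(\lambda^1_{\kappa'_1}\times\cdots\times\lambda^1_{\kappa'_{l'}}\big)$$ whenever $$k(1)\kappa_1+\cdots+k(l)\kappa_l=r\big(k'(1)\kappa'_1+\cdots+k'(l')\kappa'_{l'}\big)$$ for some tuples $(k(1),\dots,k(l))$ and $(k'(1),\dots,k'(l'))$ of elements of $K$ that are not rearrangements of each other. Here $+$ denotes concatenation of sequences, $d\kappa$ is the sequence with entries $d\kappa(a)$, and $r$ acts on points of $X^t$ and on $\mathbb Z^t$ by $(x_1,\dots,x_t)\mapsto(x_{r(1)},\dots,x_{r(t)})$ and on measures on $X^t$ by push-forward along this map. -/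

import Mathlib

open MeasureTheory

noncomputable section

namespace SpectralDL

/-- The Borel `σ`-algebra of the unit circle. -/
instance instMeasurableSpaceCircle : MeasurableSpace Circle := borel Circle

instance instBorelSpaceCircle : BorelSpace Circle := ⟨rfl⟩

/-! ### The group `L⁰(μ, 𝕋)` with the topology of convergence in measure

`X →ₘ[μ] Circle` is Mathlib's group of `μ`-classes of measurable functions into the unit circle.
Its topology is the one with basis the balls `{f | ∫ |f - f₀| dμ < ε}`; since the functions are
bounded by `1` and `μ` is finite, this is convergence in measure. -/

theorem integrable_norm_sub {X : Type*} [MeasurableSpace X] {μ : Measure X} [IsFiniteMeasure μ]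
    (f g : X →ₘ[μ] Circle) : Integrable (fun x => ‖(f x : ℂ) - (g x : ℂ)‖) μ := by
  have hf : AEStronglyMeasurable (fun x => (f x : ℂ)) μ :=
    continuous_subtype_val.comp_aestronglyMeasurable f.aestronglyMeasurable
  have hg : AEStronglyMeasurable (fun x => (g x : ℂ)) μ :=
    continuous_subtype_val.comp_aestronglyMeasurable g.aestronglyMeasurable
  refine ((Integrable.of_bound hf 1 ?_).sub (Integrable.of_bound hg 1 ?_)).norm <;>
    exact Filter.Eventually.of_forall fun x => (Circle.norm_coe _).le

instance instMetricSpaceL0 {X : Type*} [MeasurableSpace X] {μ : Measure X} [IsFiniteMeasure μ] :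
    MetricSpace (X →ₘ[μ] Circle) where
  dist f g := ∫ x, ‖(f x : ℂ) - (g x : ℂ)‖ ∂μ
  dist_self f := by simp
  dist_comm f g := by simp only [norm_sub_rev]
  dist_triangle f g h := by
    rw [← integral_add (integrable_norm_sub f g) (integrable_norm_sub g h)]
    exact integral_mono (integrable_norm_sub f h)
      ((integrable_norm_sub f g).add (integrable_norm_sub g h))
      (fun x => norm_sub_le_norm_sub_add_norm_sub _ _ _)
  eq_of_dist_eq_zero {f g} h := by
    have h0 := (integral_eq_zero_iff_of_nonneg (fun x => norm_nonneg _)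
      (integrable_norm_sub f g)).1 h
    refine AEEqFun.ext ?_
    filter_upwards [h0] with x hx
    exact Circle.ext (sub_eq_zero.1 (norm_eq_zero.1 hx))

/-- A homomorphism into the unitary group of `H` is continuous for the strong operator topology,
i.e. for pointwise convergence on `H`. -/
def StronglyContinuous {G H : Type*} [Group G] [TopologicalSpace G] [NormedAddCommGroup H]
    [InnerProductSpace ℂ H] [CompleteSpace H] (Φ : G →* unitary (H →L[ℂ] H)) : Prop :=
  ∀ v : H, Continuous fun g => (Φ g : H →L[ℂ] H) v

/-! ### Spectral measures, maximal spectral type, convolutions -/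

/-- `σ` is the spectral measure of the vector `h` for the unitary operator `u`: it is a finite
Borel measure on the circle with `⟨uᵏ h, h⟩ = ∫ zᵏ dσ(z)` for every integer `k`
(Mathlib's inner product is linear in its second argument). -/
def IsSpectralMeasure {H : Type*} [NormedAddCommGroup H] [InnerProductSpace ℂ H]
    [CompleteSpace H] (u : unitary (H →L[ℂ] H)) (h : H) (σ : Measure Circle) : Prop :=
  IsFiniteMeasure σ ∧
    ∀ k : ℤ, inner ℂ h (((u ^ k : unitary (H →L[ℂ] H)) : H →L[ℂ] H) h)
      = ∫ z : Circle, (z : ℂ) ^ k ∂σ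

/-- `σ` represents the maximal spectral type of `u`: it is the spectral measure of some vector, and
the spectral measure of every vector is absolutely continuous with respect to it. Such a `σ` exists
on a separable Hilbert space and is unique up to mutual absolute continuity. -/
def IsMaximalSpectralType {H : Type*} [NormedAddCommGroup H] [InnerProductSpace ℂ H]
    [CompleteSpace H] (u : unitary (H →L[ℂ] H)) (σ : Measure Circle) : Prop :=
  (∃ h : H, IsSpectralMeasure u h σ) ∧
    ∀ (v : H) (ρ : Measure Circle), IsSpectralMeasure u v ρ → ρ ≪ σ

/-- The convolution `σ₁ ∗ ⋯ ∗ σ_l` of measures on the circle: the image of the product measure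
under multiplication. -/
def convolution {l : ℕ} (σ : Fin l → Measure Circle) : Measure Circle :=
  (Measure.pi σ).map fun z => ∏ i, z i

/-- The tuple `k'` is a rearrangement of the tuple `k`; in particular they have equal length. -/
def IsRearrangement {l l' : ℕ} (k : Fin l → ℤ) (k' : Fin l' → ℤ) : Prop :=
  ∃ s : Fin l' ≃ Fin l, ∀ j, k' j = k (s j)

/-- The DL-condition with coefficients in a set `K` of integers: for all `f` in a dense `G_δ` set,
the convolutions of the maximal spectral types of `Φ(f)^{k(1)}, …, Φ(f)^{k(l)}` and of
`Φ(f)^{k'(1)}, …, Φ(f)^{k'(l')}` are mutually singular, for all nonempty tuples `k`, `k'` with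
entries in `K` that are not rearrangements of each other. -/
def DLCondition (K : Set ℤ) {X : Type*} [MeasurableSpace X] {μ : Measure X} [IsFiniteMeasure μ]
    {H : Type*} [NormedAddCommGroup H] [InnerProductSpace ℂ H] [CompleteSpace H]
    (Φ : (X →ₘ[μ] Circle) →* unitary (H →L[ℂ] H)) : Prop :=
  ∃ G : Set (X →ₘ[μ] Circle), IsGδ G ∧ Dense G ∧
    ∀ f ∈ G, ∀ (l l' : ℕ) (k : Fin l → ℤ) (k' : Fin l' → ℤ), 0 < l → 0 < l' →
      (∀ i, k i ∈ K) → (∀ j, k' j ∈ K) → ¬ IsRearrangement k k' →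
      ∀ (σ : Fin l → Measure Circle) (σ' : Fin l' → Measure Circle),
        (∀ i, IsMaximalSpectralType (Φ f ^ k i) (σ i)) →
        (∀ j, IsMaximalSpectralType (Φ f ^ k' j) (σ' j)) →
        (convolution σ).MutuallySingular (convolution σ')

/-! ### The representations `σ(κ, λ)` and their direct sums -/

/-- The set `S` of nonempty nondecreasing finite sequences of non-zero integers. -/
structure Weight where
  /-- the length `|κ|` -/
  len : ℕ
  len_pos : 0 < len
  /-- the entries -/
  entry : Fin len → ℤ
  entry_ne_zero : ∀ j, entry j ≠ 0
  monotone_entry : Monotone entry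

/-- `f^κ(x₁, …, x_n) = ∏ f(x_j)^{k(j)}` as a complex number. It depends on the representative of
`f` only up to null sets of measures whose marginals are absolutely continuous with respect to
`μ`. -/
def powWeight {X : Type*} [MeasurableSpace X] {μ : Measure X} (f : X →ₘ[μ] Circle) (κ : Weight)
    (x : Fin κ.len → X) : ℂ :=
  ((∏ j, f (x j) ^ κ.entry j : Circle) : ℂ)

/-- The conditions on the measures `λ_κ^i` on `X^{|κ|}`, `i = 1, 2, …`, of Solecki's form. -/
structure IsSoleckiFamily {X : Type*} [MeasurableSpace X] (μ : Measure X)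
    (lam : (κ : Weight) → ℕ+ → Measure (Fin κ.len → X)) : Prop where
  finite : ∀ κ i, IsFiniteMeasure (lam κ i)
  marginal : ∀ κ i (j : Fin κ.len), (lam κ i).map (fun x => x j) ≪ μ
  diagonal : ∀ κ i (a b : Fin κ.len), a < b → lam κ i {x | x a = x b} = 0
  decreasing : ∀ κ (i j : ℕ+), i < j → lam κ j ≪ lam κ i

/-- `Φ` is (unitarily equivalent to) the Hilbert space direct sum of the representations
`σ(κ, λ_κ^i)`: there is an isometric isomorphism of `H` with the `ℓ²`-sum of the spaces
`L²(λ_κ^i)` carrying `Φ(f)` to multiplication by `f^κ` in the summand indexed by `(κ, i)`. -/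
def IsDirectSumOfMultiplications {X : Type*} [MeasurableSpace X] {μ : Measure X}
    {H : Type*} [NormedAddCommGroup H] [InnerProductSpace ℂ H] [CompleteSpace H]
    (Φ : (X →ₘ[μ] Circle) →* unitary (H →L[ℂ] H))
    (lam : (κ : Weight) → ℕ+ → Measure (Fin κ.len → X)) : Prop :=
  ∃ U : H ≃ₗᵢ[ℂ] lp (fun p : Weight × ℕ+ => Lp ℂ 2 (lam p.1 p.2)) 2,
    ∀ (f : X →ₘ[μ] Circle) (v : H) (κ : Weight) (i : ℕ+),
      ⇑(U ((Φ f : H →L[ℂ] H) v) (κ, i)) =ᵐ[lam κ i]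
        fun x => powWeight f κ x * (U v (κ, i) : (Fin κ.len → X) → ℂ) x

/-! ### The orthogonality relations

The coordinates of `X^t`, `t = |κ₁| + ⋯ + |κ_l|`, are indexed by the pairs `(i, a)` with `i ≤ l` and
`a ≤ |κ_i|`. Accordingly, an element of `S_t` relating two such decompositions of `t` is a bijection
between the two index sets (which exists exactly when the total lengths agree). -/

/-- The index set of the coordinates of the concatenation of `κ₁, …, κ_l`. -/
abbrev ConcatIndex {l : ℕ} (κ : Fin l → Weight) : Type := Σ i : Fin l, Fin (κ i).len

/-- The concatenation `k(1)κ₁ + ⋯ + k(l)κ_l`. -/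
def concat {l : ℕ} (k : Fin l → ℤ) (κ : Fin l → Weight) : ConcatIndex κ → ℤ :=
  fun p => k p.1 * (κ p.1).entry p.2

/-- The product measure `λ_{κ₁}^1 × ⋯ × λ_{κ_l}^1` on `X^t`. -/
def prodMeasure {X : Type*} [MeasurableSpace X]
    (lam : (κ : Weight) → ℕ+ → Measure (Fin κ.len → X)) {l : ℕ} (κ : Fin l → Weight) :
    Measure (ConcatIndex κ → X) :=
  (Measure.pi fun i => lam (κ i) 1).map fun y p => y p.1 p.2

/-- The orthogonality relations with coefficients in a set `K` of integers. A bijection `r` acts on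
points, tuples and measures by permuting coordinates, `(x_p)_p ↦ (x_{r(p)})_p`. -/
def OrthogonalityRelations (K : Set ℤ) {X : Type*} [MeasurableSpace X]
    (lam : (κ : Weight) → ℕ+ → Measure (Fin κ.len → X)) : Prop :=
  ∀ (l l' : ℕ) (κ : Fin l → Weight) (κ' : Fin l' → Weight)
    (r : ConcatIndex κ ≃ ConcatIndex κ') (k : Fin l → ℤ) (k' : Fin l' → ℤ), 0 < l → 0 < l' →
    (∀ i, k i ∈ K) → (∀ j, k' j ∈ K) → ¬ IsRearrangement k k' →
    (∀ p, concat k κ p = concat k' κ' (r p)) →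
    (prodMeasure lam κ).MutuallySingular
      ((prodMeasure lam κ').map fun (x : ConcatIndex κ' → X) p => x (r p))

end SpectralDL

end

/-!
The spectral measure of `v` under multiplication by `m` on an `ℓ²`-sum of spaces `L²(ρ i)` is the
sum of the images of `‖v i‖² ρ i` under `m`. As `λ_κ^i ≪ λ_κ^1`, the maximal spectral type of
`Φ(f)^k` is therefore equivalent to the sum over `κ` of the images of `λ_κ^1` under `f^{kκ}`. So at
a fixed `f` the singularity of the two convolutions means that all images of
`λ_{κ₁}^1 × ⋯ × λ_{κ_l}^1` under `f^{k(1)κ₁ + ⋯ + k(l)κ_l}` are singular to those coming from the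
primed tuples.

Let `A`, `B` be two such products, with exponents `α`, `β`. If `α = β ∘ r`, then `f^β` is `f^α`
after permuting coordinates by `r`, so singularity of the images of `A` and `B` forces `A ⟂ r(B)`.
Conversely, let `A ⟂ r(B)` whenever `α = β ∘ r`. Approximate `f` by a step function over a fine
partition, with multiplicatively independent values. For it, `f^α(x) = f^β(y)` only if some `r` with
`α = β ∘ r` matches the cells of `x` with those of `y`, as long as the coordinates of `x` and of `y`
lie in distinct cells; so up to `ε` the images live on disjoint finite sets. This `ε`-separation
is an open condition on `f`, hence generic `f` satisfy it for all `ε` by Baire's theorem in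
`L⁰(μ, 𝕋)`, and there are only countably many pairs of weights to treat.
-/

namespace SpectralDL

open Set Filter Topology
open scoped NNReal ENNReal

theorem addCircle_measure_ext {T : ℝ} [Fact (0 < T)] {a b : Measure (AddCircle T)}
    [IsFiniteMeasure a] [IsFiniteMeasure b]
    (h : ∀ n : ℤ, ∫ x, fourier n x ∂a = ∫ x, fourier n x ∂b) : a = b := by
  let I (m : Measure (AddCircle T)) [IsFiniteMeasure m] : C(AddCircle T, ℂ) →L[ℂ] ℂ :=
    (L1.integralCLM' ℂ).comp (ContinuousMap.toLp 1 m ℂ)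
  have I_apply (m : Measure (AddCircle T)) [IsFiniteMeasure m] (g : C(AddCircle T, ℂ)) :
      I m g = ∫ x, g x ∂m := by
    rw [← integral_congr_ae (ContinuousMap.coeFn_toLp (p := 1) (𝕜 := ℂ) m g),
      ← L1.integral_eq_integral, L1.integral_eq' ℂ]
    rfl
  have hI : I a = I b := by
    refine ContinuousLinearMap.ext_on
      ((Submodule.dense_iff_topologicalClosure_eq_top).2 span_fourier_closure_eq_top) ?_
    rintro - ⟨n, rfl⟩
    simpa only [I_apply] using h n
  refine ext_of_forall_integral_eq_of_IsFiniteMeasure fun g => ?_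
  have hg := DFunLike.congr_fun hI ⟨fun x => (g x : ℂ), by fun_prop⟩
  simp only [I_apply, ContinuousMap.coe_mk, integral_complex_ofReal] at hg
  exact_mod_cast hg

theorem circle_measure_ext {a b : Measure Circle} [IsFiniteMeasure a] [IsFiniteMeasure b]
    (h : ∀ n : ℤ, ∫ z : Circle, (z : ℂ) ^ n ∂a = ∫ z : Circle, (z : ℂ) ^ n ∂b) : a = b := by
  let e : Circle ≃ᵐ UnitAddCircle :=
    (AddCircle.homeomorphCircle one_ne_zero).symm.toMeasurableEquiv
  have he (n : ℤ) (z : Circle) : fourier n (e z) = (z : ℂ) ^ n := by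
    rw [fourier_apply, AddCircle.toCircle_zsmul, ← AddCircle.homeomorphCircle_apply one_ne_zero,
      Circle.coe_zpow]
    exact congrArg (fun z : Circle => (z : ℂ) ^ n) (Homeomorph.apply_symm_apply _ z)
  refine e.map_measurableEquiv_injective (addCircle_measure_ext fun n => ?_)
  simpa only [integral_map_equiv, he] using h n

theorem pi_absolutelyContinuous_sum {ι : Type*} [Countable ι] :
    ∀ {l : ℕ} {Y : Fin l → Type*} [∀ i, MeasurableSpace (Y i)] {σ : ∀ i, Measure (Y i)}
      {τ : ∀ i, ι → Measure (Y i)} [∀ i, SigmaFinite (σ i)] [∀ i j, SigmaFinite (τ i j)],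
      (∀ i, σ i ≪ Measure.sum (τ i)) →
      Measure.pi σ ≪ Measure.sum fun p : Fin l → ι => Measure.pi fun i => τ i (p i) := by
  intro l
  induction l with
  | zero =>
    intro Y _ σ τ _ _ _
    refine Measure.AbsolutelyContinuous.mk fun s hs h0 => ?_
    rw [Measure.sum_apply _ hs, ENNReal.tsum_eq_zero] at h0
    rw [← h0 finZeroElim, Measure.pi_of_empty σ, Measure.pi_of_empty]
  | succ l ih =>
    intro Y _ σ τ _ _ h
    have hprod := (h 0).prod (ih fun j => h (Fin.succAbove 0 j))
    rw [Measure.prod_sum] at hprod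
    refine Measure.AbsolutelyContinuous.mk fun s hs h0 => ?_
    rw [Measure.sum_apply _ hs, ENNReal.tsum_eq_zero] at h0
    rw [← ((measurePreserving_piFinSuccAbove σ 0).symm _).map_eq, MeasurableEquiv.map_apply]
    refine hprod ?_
    rw [Measure.sum_apply _ (MeasurableEquiv.measurable _ hs), ENNReal.tsum_eq_zero]
    rintro ⟨i, p⟩
    have hip := h0 (Fin.cons i p)
    rw [← ((measurePreserving_piFinSuccAbove
      (fun j => τ j ((Fin.cons i p : Fin (l + 1) → ι) j)) 0).symm _).map_eq,
      MeasurableEquiv.map_apply] at hip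
    simpa using hip

theorem pi_absolutelyContinuous {l : ℕ} {Y : Fin l → Type*} [∀ i, MeasurableSpace (Y i)]
    {σ τ : ∀ i, Measure (Y i)} [∀ i, SigmaFinite (σ i)] [∀ i, SigmaFinite (τ i)]
    (h : ∀ i, σ i ≪ τ i) : Measure.pi σ ≪ Measure.pi τ := by
  have := pi_absolutelyContinuous_sum (τ := fun i (_ : Unit) => τ i) fun i => by simpa using h i
  simpa using this

/-! ### Separation up to `ε` -/

/-- Two measures are `ε`-separated if the space splits into two complementary fuzzy parts, given by
a continuous partition of unity, the first of `a`-mass and the second of `b`-mass less than `ε`.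
Continuous functions are used instead of sets in order that the condition be open in the pair of
measures. -/
def AlmostSeparated {Y : Type*} [MeasurableSpace Y] [TopologicalSpace Y] (ε : ℝ≥0∞)
    (a b : Measure Y) : Prop :=
  ∃ g h : C(Y, ℝ≥0), g + h = 1 ∧ ∫⁻ y, g y ∂a < ε ∧ ∫⁻ y, h y ∂b < ε

section AlmostSeparated

variable {Y : Type*} [MeasurableSpace Y] [TopologicalSpace Y] {a b : Measure Y} {ε : ℝ≥0∞}

theorem AlmostSeparated.mono {δ : ℝ≥0∞} (h : AlmostSeparated ε a b) (hδ : ε ≤ δ) :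
    AlmostSeparated δ a b := by
  obtain ⟨g, g', hg, ha, hb⟩ := h
  exact ⟨g, g', hg, ha.trans_le hδ, hb.trans_le hδ⟩

theorem mutuallySingular_of_forall_almostSeparated [OpensMeasurableSpace Y]
    (h : ∀ ε, 0 < ε → AlmostSeparated ε a b) : a ⟂ₘ b := by
  refine Measure.mutuallySingular_of_disjoint (disjoint_iff_inf_le.2 ?_)
  have hmass : (a ⊓ b) univ = 0 := by
    refine nonpos_iff_eq_zero.1 (le_of_forall_pos_le_add fun ε hε => ?_)
    obtain ⟨g, g', hg, ha, hb⟩ := h (ε / 2) (ENNReal.half_pos hε.ne')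
    have hsum (y : Y) : (g y + g' y : ℝ≥0∞) = 1 := by
      rw [← ENNReal.coe_add, ← ContinuousMap.add_apply, hg, ContinuousMap.one_apply,
        ENNReal.coe_one]
    calc (a ⊓ b) univ = ∫⁻ y, (g y + g' y : ℝ≥0∞) ∂(a ⊓ b) := by
          simp only [hsum, lintegral_one]
      _ = ∫⁻ y, g y ∂(a ⊓ b) + ∫⁻ y, g' y ∂(a ⊓ b) :=
          lintegral_add_left (by fun_prop) _
      _ ≤ ∫⁻ y, g y ∂a + ∫⁻ y, g' y ∂b :=
          add_le_add (lintegral_mono' inf_le_left le_rfl) (lintegral_mono' inf_le_right le_rfl)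
      _ ≤ ε / 2 + ε / 2 := add_le_add ha.le hb.le
      _ = 0 + ε := by rw [ENNReal.add_halves, zero_add]
  rw [Measure.measure_univ_eq_zero.1 hmass]
  exact bot_le

theorem AlmostSeparated.of_disjoint_isClosed [NormalSpace Y] [OpensMeasurableSpace Y] {S T : Set Y}
    (hS : IsClosed S) (hT : IsClosed T) (hST : Disjoint S T) (ha : a Sᶜ < ε) (hb : b Tᶜ < ε) :
    AlmostSeparated ε a b := by
  obtain ⟨g, hgS, hgT, hg⟩ := exists_continuous_zero_one_of_isClosed hS hT hST
  have lintegral_lt {m : Measure Y} {C : Set Y} (hC : IsClosed C) (hm : m Cᶜ < ε) (u : Y → ℝ≥0)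
      (hu : ∀ y, u y ≤ 1) (huC : ∀ y ∈ C, u y = 0) : ∫⁻ y, u y ∂m < ε := by
    refine lt_of_le_of_lt ?_ hm
    rw [← lintegral_indicator_one hC.measurableSet.compl]
    refine lintegral_mono fun y => ?_
    by_cases hy : y ∈ C
    · simp [huC y hy]
    · simpa [hy] using hu y
  let u (y : Y) : ℝ≥0 := ⟨g y, (hg y).1⟩
  have hu (y : Y) : u y ≤ 1 := (hg y).2
  have hu_cont : Continuous u := g.continuous.subtype_mk _
  refine ⟨⟨u, hu_cont⟩, ⟨fun y => 1 - u y, continuous_const.sub hu_cont⟩, ?_,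
    lintegral_lt hS ha u hu fun y hy => ?_, lintegral_lt hT hb _ (fun y => tsub_le_self)
      fun y hy => ?_⟩
  · ext y
    simp [hu y]
  · exact NNReal.eq (hgS hy)
  · have huy : u y = 1 := NNReal.eq (hgT hy)
    simp [huy]

end AlmostSeparated

theorem dense_setOf_monoidHom_ne_one {G N : Type*} [Group G] [TopologicalSpace G]
    [IsTopologicalGroup G] [PreconnectedSpace G] [Group N] [TopologicalSpace N] [T1Space N]
    {χ : G →* N} (hχ : Continuous χ) {g₀ : G} (hg₀ : χ g₀ ≠ 1) : Dense {g | χ g ≠ 1} := by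
  change Dense (χ.ker : Set G)ᶜ
  rw [← interior_eq_empty_iff_dense_compl]
  by_contra! hne
  obtain ⟨g, hg⟩ := hne
  have hopen : IsOpen (χ.ker : Set G) :=
    χ.ker.isOpen_of_mem_nhds (mem_interior_iff_mem_nhds.1 hg)
  have hclosed : IsClosed (χ.ker : Set G) := isClosed_singleton.preimage hχ
  have huniv := IsClopen.eq_univ ⟨hclosed, hopen⟩ ⟨1, χ.ker.one_mem⟩
  exact hg₀ (huniv.ge (mem_univ g₀))

theorem exists_circle_zpow_ne_one {n : ℤ} (hn : n ≠ 0) : ∃ z : Circle, z ^ n ≠ 1 := by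
  refine ⟨Circle.exp (Real.pi / n), ?_⟩
  rw [← Circle.exp_intCast_mul, mul_div_cancel₀ _ (Int.cast_ne_zero.2 hn)]
  exact Circle.exp_pi_ne_one

theorem dense_linearIndependent_circle (C : Type*) [Countable C] :
    Dense {c : C → Circle | LinearIndependent ℤ fun j => Additive.ofMul (c j)} := by
  classical
  let χ (v : C →₀ ℤ) : (C → Circle) →* Circle :=
    { toFun := fun c => ∏ j ∈ v.support, c j ^ v j
      map_one' := by simp
      map_mul' := fun c d => by simp [mul_zpow, Finset.prod_mul_distrib] }
  have hχ (v : C →₀ ℤ) : Continuous (χ v) := by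
    change Continuous fun c : C → Circle => ∏ j ∈ v.support, c j ^ v j
    fun_prop
  have hset : {c : C → Circle | LinearIndependent ℤ fun j => Additive.ofMul (c j)}
      = ⋂ v : {v : C →₀ ℤ // v ≠ 0}, {c | χ v.1 c ≠ 1} := by
    ext c
    simp only [linearIndependent_iff, mem_ofPred_eq, mem_iInter, Subtype.forall, ne_eq]
    exact forall_congr' fun v => not_imp_not.symm
  rw [hset]
  refine dense_iInter_of_isOpen (fun v => ?_) fun ⟨v, hv⟩ => ?_
  · exact (isClosed_singleton.preimage (hχ v.1)).isOpen_compl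
  · obtain ⟨j, hj⟩ := Finsupp.support_nonempty_iff.2 hv
    obtain ⟨z, hz⟩ := exists_circle_zpow_ne_one (Finsupp.mem_support_iff.1 hj)
    refine dense_setOf_monoidHom_ne_one (hχ v) (g₀ := Pi.mulSingle j z) ?_
    change ∏ i ∈ v.support, (Pi.mulSingle j z : C → Circle) i ^ v i ≠ 1
    rwa [Finset.prod_eq_single_of_mem j hj fun i _ hi => by simp [Pi.mulSingle_eq_of_ne hi],
      Pi.mulSingle_eq_same]

theorem exists_equiv_of_sum_smul_eq {R M C P Q : Type*} [Ring R] [AddCommGroup M] [Module R M]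
    [Fintype P] [Fintype Q] {b : C → M} (hb : LinearIndependent R b) {J : P → C} {J' : Q → C}
    (hJ : Function.Injective J) (hJ' : Function.Injective J') {α : P → R} {β : Q → R}
    (hα : ∀ p, α p ≠ 0) (hβ : ∀ q, β q ≠ 0) (h : ∑ p, α p • b (J p) = ∑ q, β q • b (J' q)) :
    ∃ r : P ≃ Q, (∀ p, J' (r p) = J p) ∧ ∀ p, α p = β (r p) := by
  classical
  let a : P →₀ R := Finsupp.equivFunOnFinite.symm α
  let a' : Q →₀ R := Finsupp.equivFunOnFinite.symm β
  have hmap : a.mapDomain J = a'.mapDomain J' := by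
    refine hb.finsuppLinearCombination_injective ?_
    rw [Finsupp.linearCombination_mapDomain, Finsupp.linearCombination_mapDomain,
      Finsupp.linearCombination_apply, Finsupp.linearCombination_apply,
      Finsupp.sum_fintype _ _ (by simp), Finsupp.sum_fintype _ _ (by simp)]
    exact h
  have hrange : range J = range J' := by
    have hsupp := congrArg (fun c : C →₀ R => (c.support : Set C)) hmap
    have ha : a.support = Finset.univ :=
      Finset.eq_univ_iff_forall.2 fun p => by simpa [a] using hα p
    have ha' : a'.support = Finset.univ :=
      Finset.eq_univ_iff_forall.2 fun q => by simpa [a'] using hβ q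
    simpa [Finsupp.mapDomain_support_of_injective, hJ, hJ', ha, ha'] using hsupp
  let r : P ≃ Q := (Equiv.ofInjective J hJ).trans
    ((Equiv.setCongr hrange).trans (Equiv.ofInjective J' hJ').symm)
  have hr (p : P) : J' (r p) = J p :=
    Equiv.apply_ofInjective_symm hJ' (Equiv.setCongr hrange (Equiv.ofInjective J hJ p))
  refine ⟨r, hr, fun p => ?_⟩
  have hp := DFunLike.congr_fun hmap (J p)
  rw [Finsupp.mapDomain_apply hJ, ← hr p, Finsupp.mapDomain_apply hJ'] at hp
  exact hp

/-! ### Completeness of `L⁰(μ, 𝕋)` -/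

section L0

variable {X : Type*} [MeasurableSpace X] {μ : Measure X} [IsFiniteMeasure μ]

theorem integrable_coe (f : X →ₘ[μ] Circle) : Integrable (fun x => (f x : ℂ)) μ :=
  .of_bound (continuous_subtype_val.comp_aestronglyMeasurable f.aestronglyMeasurable) 1
    (.of_forall fun _ => (Circle.norm_coe _).le)

/-- The inclusion of `L⁰(μ, 𝕋)` into `L¹(μ, ℂ)`, which is isometric by the choice of the metric. -/
noncomputable def toL1 (f : X →ₘ[μ] Circle) : X →₁[μ] ℂ :=
  (integrable_coe f).toL1 _

theorem coeFn_toL1 (f : X →ₘ[μ] Circle) : toL1 f =ᵐ[μ] fun x => (f x : ℂ) :=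
  (integrable_coe f).coeFn_toL1

theorem isometry_toL1 : Isometry (toL1 : (X →ₘ[μ] Circle) → X →₁[μ] ℂ) := by
  refine Isometry.of_dist_eq fun f g => ?_
  rw [L1.dist_eq_integral_dist]
  refine integral_congr_ae ?_
  filter_upwards [coeFn_toL1 f, coeFn_toL1 g] with x hf hg
  rw [hf, hg, dist_eq_norm]

theorem exists_subseq_ae_tendsto {u : ℕ → X →ₘ[μ] Circle} {f : X →ₘ[μ] Circle}
    (hu : Tendsto u atTop (𝓝 f)) : ∃ ns : ℕ → ℕ, StrictMono ns ∧
      ∀ᵐ x ∂μ, Tendsto (fun n => u (ns n) x) atTop (𝓝 (f x)) := by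
  obtain ⟨ns, hns, hlim⟩ := (tendstoInMeasure_of_tendsto_Lp
    ((isometry_toL1.continuous.tendsto f).comp hu)).exists_seq_tendsto_ae
  refine ⟨ns, hns, ?_⟩
  filter_upwards [hlim, coeFn_toL1 f, ae_all_iff.2 fun n => coeFn_toL1 (u n)] with x hx hf hun
  simp only [Function.comp_apply, hf, hun] at hx
  exact tendsto_subtype_rng.2 hx

theorem range_toL1 :
    range (toL1 : (X →ₘ[μ] Circle) → X →₁[μ] ℂ) = {w | ∀ᵐ x ∂μ, ‖w x‖ = 1} := by
  refine Subset.antisymm ?_ fun w hw => ?_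
  · rintro - ⟨f, rfl⟩
    filter_upwards [coeFn_toL1 f] with x hx
    rw [hx, Circle.norm_coe]
  · let F (x : X) : Circle := Circle.exp (Complex.arg (w x))
    have hF : AEStronglyMeasurable F μ := (Circle.exp.continuous.measurable.comp
      (Complex.measurable_arg.comp (Lp.stronglyMeasurable w).measurable)).aestronglyMeasurable
    refine ⟨AEEqFun.mk F hF, Lp.ext ?_⟩
    filter_upwards [hw, coeFn_toL1 (AEEqFun.mk F hF), AEEqFun.coeFn_mk F hF] with x hx h₁ h₂
    rw [h₁, h₂, Circle.coe_exp]
    simpa only [hx, Complex.ofReal_one, one_mul] using Complex.norm_mul_exp_arg_mul_I (w x)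

theorem isClosed_range_toL1 :
    IsClosed (range (toL1 : (X →ₘ[μ] Circle) → X →₁[μ] ℂ)) := by
  rw [range_toL1]
  refine IsSeqClosed.isClosed fun u w hu hw => ?_
  obtain ⟨ns, -, hns⟩ := (tendstoInMeasure_of_tendsto_Lp hw).exists_seq_tendsto_ae
  filter_upwards [hns, ae_all_iff.2 hu] with x hx hux
  refine tendsto_nhds_unique hx.norm ?_
  simp only [hux, tendsto_const_nhds]

instance instCompleteSpaceL0 : CompleteSpace (X →ₘ[μ] Circle) :=
  isometry_toL1.isUniformInducing.completeSpace isClosed_range_toL1.isComplete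

end L0

/-! ### Monomials in a circle-valued function -/

theorem mutuallySingular_of_map {Y Z : Type*} [MeasurableSpace Y] [MeasurableSpace Z]
    {a b : Measure Y} {φ : Y → Z} (hφ : Measurable φ) (h : a.map φ ⟂ₘ b.map φ) : a ⟂ₘ b := by
  obtain ⟨s, hs, ha, hb⟩ := h
  rw [Measure.map_apply hφ hs] at ha
  rw [Measure.map_apply hφ hs.compl] at hb
  exact ⟨φ ⁻¹' s, hφ hs, ha, hb⟩

theorem measure_map_compl_image_le {Y Z : Type*} [MeasurableSpace Y] [MeasurableSpace Z]
    {a : Measure Y} {φ ψ : Y → Z} (hφ : Measurable φ) (h : φ =ᵐ[a] ψ) {E : Set Y}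
    (hE : MeasurableSet (ψ '' E)) : a.map φ (ψ '' E)ᶜ ≤ a Eᶜ := by
  rw [Measure.map_apply hφ hE.compl]
  refine measure_mono_ae ?_
  filter_upwards [h] with y hy hyE hy'
  exact hyE ⟨y, hy', hy.symm⟩

/-- The monomial `f^α(x) = ∏ f(x_p)^{α(p)}` in the values of a circle-valued function `f`, with
exponents `α` indexed by an arbitrary finite set of coordinates. -/
noncomputable def evalPow {X P : Type*} [Fintype P] (f : X → Circle) (α : P → ℤ)
    (x : P → X) : Circle :=
  ∏ p, f (x p) ^ α p

section EvalPow

variable {X P Q : Type*} [Fintype P] [Fintype Q]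

theorem evalPow_comp_equiv {α : P → ℤ} {β : Q → ℤ} {r : P ≃ Q} (h : ∀ p, α p = β (r p))
    (f : X → Circle) (y : Q → X) : evalPow f α (fun p => y (r p)) = evalPow f β y := by
  unfold evalPow
  rw [← Equiv.prod_comp r]
  exact Finset.prod_congr rfl fun p _ => by rw [h]

theorem finite_range_evalPow_comp {C : Type*} [Finite C] (c : C → Circle) (q : X → C)
    (α : P → ℤ) : (range (evalPow (c ∘ q) α)).Finite :=
  (finite_range (evalPow c α)).subset (range_subset_iff.2 fun x => mem_range_self (q ∘ x))

theorem exists_equiv_of_evalPow_comp_eq {C : Type*} {c : C → Circle}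
    (hc : LinearIndependent ℤ fun j => Additive.ofMul (c j)) {q : X → C} {α : P → ℤ}
    {β : Q → ℤ} (hα : ∀ p, α p ≠ 0) (hβ : ∀ q, β q ≠ 0) {x : P → X} {y : Q → X}
    (hx : Function.Injective (q ∘ x)) (hy : Function.Injective (q ∘ y))
    (h : evalPow (c ∘ q) α x = evalPow (c ∘ q) β y) :
    ∃ r : P ≃ Q, (∀ p, q (y (r p)) = q (x p)) ∧ ∀ p, α p = β (r p) :=
  exists_equiv_of_sum_smul_eq hc hx hy hα hβ (congrArg Additive.ofMul h)

variable [MeasurableSpace X]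

theorem measurable_evalPow {f : X → Circle} (hf : Measurable f) (α : P → ℤ) :
    Measurable (evalPow f α) :=
  Finset.measurable_fun_prod _ fun p _ =>
    (continuous_zpow (α p)).measurable.comp (hf.comp (measurable_pi_apply p))

theorem mutuallySingular_map_perm_of_map_evalPow {A : Measure (P → X)} {B : Measure (Q → X)}
    {α : P → ℤ} {β : Q → ℤ} {r : P ≃ Q} (hr : ∀ p, α p = β (r p)) {f : X → Circle}
    (hf : Measurable f) (h : A.map (evalPow f α) ⟂ₘ B.map (evalPow f β)) :
    A ⟂ₘ B.map fun y p => y (r p) := by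
  refine mutuallySingular_of_map (measurable_evalPow hf α) ?_
  have hperm : Measurable fun (y : Q → X) p => y (r p) :=
    measurable_pi_lambda _ fun p => measurable_pi_apply _
  rwa [Measure.map_map (measurable_evalPow hf α) hperm,
    show evalPow f α ∘ (fun y p => y (r p)) = evalPow f β from funext (evalPow_comp_equiv hr f)]

variable {μ : Measure X}

theorem ae_forall_of_marginal {P : Type*} [Countable P] {A : Measure (P → X)}
    (hA : ∀ p, A.map (fun x => x p) ≪ μ) {s : X → Prop} (hs : ∀ᵐ x ∂μ, s x) :
    ∀ᵐ x ∂A, ∀ p, s (x p) :=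
  ae_all_iff.2 fun p => ae_of_ae_map (measurable_pi_apply p).aemeasurable ((hA p).ae_le hs)

theorem evalPow_congr_ae {A : Measure (P → X)} (hA : ∀ p, A.map (fun x => x p) ≪ μ)
    {f g : X → Circle} (hfg : f =ᵐ[μ] g) (α : P → ℤ) : evalPow f α =ᵐ[A] evalPow g α := by
  filter_upwards [ae_forall_of_marginal hA hfg] with x hx
  exact Finset.prod_congr rfl fun p _ => by rw [hx]

variable [IsFiniteMeasure μ]

theorem continuous_lintegral_map_evalPow {A : Measure (P → X)} [IsFiniteMeasure A]
    (hA : ∀ p, A.map (fun x => x p) ≪ μ) (α : P → ℤ) (g : C(Circle, ℝ≥0)) :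
    Continuous fun f : X →ₘ[μ] Circle => ∫⁻ z, g z ∂A.map (evalPow f α) := by
  have hmeas (f : X →ₘ[μ] Circle) : Measurable (evalPow f α) := measurable_evalPow f.measurable α
  have hg : Measurable fun z => (g z : ℝ≥0∞) := g.continuous.measurable.coe_nnreal_ennreal
  simp_rw [lintegral_map hg (hmeas _)]
  refine continuous_iff_seqContinuous.2 fun u f hu => tendsto_of_subseq_tendsto fun ns hns => ?_
  obtain ⟨ms, -, hms⟩ := exists_subseq_ae_tendsto (hu.comp hns)
  obtain ⟨K, hK⟩ := (isCompact_range g.continuous).bddAbove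
  refine ⟨ms, tendsto_lintegral_of_dominated_convergence (fun _ => (K : ℝ≥0∞))
    (fun n => hg.comp (hmeas _))
    (fun n => .of_forall fun x => ENNReal.coe_le_coe.2 (hK (mem_range_self _)))
    (by simp [ENNReal.mul_eq_top]) ?_⟩
  filter_upwards [ae_forall_of_marginal hA hms] with x hx
  refine ENNReal.tendsto_coe.2 ((g.continuous.tendsto _).comp ?_)
  exact tendsto_finsetProd _ fun p _ => ((continuous_zpow (α p)).tendsto _).comp (hx p)

theorem isOpen_setOf_almostSeparated_map_evalPow {A : Measure (P → X)} {B : Measure (Q → X)}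
    [IsFiniteMeasure A] [IsFiniteMeasure B] (hA : ∀ p, A.map (fun x => x p) ≪ μ)
    (hB : ∀ q, B.map (fun x => x q) ≪ μ) (α : P → ℤ) (β : Q → ℤ) (ε : ℝ≥0∞) :
    IsOpen {f : X →ₘ[μ] Circle |
      AlmostSeparated ε (A.map (evalPow f α)) (B.map (evalPow f β))} := by
  simp only [AlmostSeparated, ofPred_exists, ofPred_and]
  exact isOpen_iUnion fun g => isOpen_iUnion fun h => isOpen_const.inter <|
    (isOpen_lt (continuous_lintegral_map_evalPow hA α g) continuous_const).inter
      (isOpen_lt (continuous_lintegral_map_evalPow hB β h) continuous_const)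

end EvalPow

/-! ### Partitions separating points -/

theorem exists_mem_measure_lt_of_mutuallySingular {Y : Type*} [m : MeasurableSpace Y]
    {a b : Measure Y} [IsFiniteMeasure a] [IsFiniteMeasure b] (h : a ⟂ₘ b) {𝒜 : Set (Set Y)}
    (h𝒜 : IsSetAlgebra 𝒜) (hgen : m = MeasurableSpace.generateFrom 𝒜) {ε : ℝ≥0∞} (hε : 0 < ε) :
    ∃ E ∈ 𝒜, a Eᶜ < ε ∧ b E < ε := by
  obtain ⟨s, hs, ha, hb⟩ := h
  obtain ⟨δ, hδ, hδε⟩ := ENNReal.lt_iff_exists_nnreal_btwn.1 hε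
  obtain ⟨E, hE, hlt⟩ := (Measure.MeasureDense.of_generateFrom_isSetAlgebra_finite (a + b)
    h𝒜 hgen).approx sᶜ hs.compl (measure_ne_top _ _) δ (by exact_mod_cast hδ)
  rw [ENNReal.ofReal_coe_nnreal, Measure.add_apply] at hlt
  refine ⟨E, hE, ?_, ?_⟩
  · calc a Eᶜ ≤ a (symmDiff sᶜ E ∪ s) := measure_mono fun x hx =>
          (em (x ∈ s)).elim Or.inr fun hxs => Or.inl (Or.inl ⟨hxs, hx⟩)
      _ ≤ a (symmDiff sᶜ E) + a s := measure_union_le _ _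
      _ ≤ a (symmDiff sᶜ E) + b (symmDiff sᶜ E) := by rw [ha, add_zero]; exact le_self_add
      _ < ε := hlt.trans hδε
  · calc b E ≤ b (symmDiff sᶜ E ∪ sᶜ) := measure_mono fun x hx =>
          (em (x ∈ sᶜ)).elim Or.inr fun hxs => Or.inl (Or.inr ⟨hx, hxs⟩)
      _ ≤ b (symmDiff sᶜ E) + b sᶜ := measure_union_le _ _
      _ ≤ a (symmDiff sᶜ E) + b (symmDiff sᶜ E) := by rw [hb, add_zero]; exact le_add_self
      _ < ε := hlt.trans hδε

theorem measure_compl_inter_lt {Y : Type*} [MeasurableSpace Y] {m : Measure Y} {S T : Set Y}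
    {ε : ℝ≥0∞} (hS : m Sᶜ < ε / 2) (hT : m Tᶜ < ε / 2) : m (S ∩ T)ᶜ < ε := by
  rw [compl_inter, ← ENNReal.add_halves ε]
  exact (measure_union_le _ _).trans_lt (ENNReal.add_lt_add hS hT)

section Bits

variable {X : Type*} [MeasurableSpace X] [MeasurableSpace.CountablyGenerated X] {P Q : Type*}

/-- The first `n` binary digits of a point of a countably generated space, that is, the first `n`
coordinates of Mathlib's map `MeasurableSpace.mapNatBool` into the Cantor space. The partitions of
`X` into the fibres of `bits n` become finer with `n`. -/
noncomputable def bits (n : ℕ) (x : X) : Fin n → Bool :=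
  fun i => MeasurableSpace.mapNatBool X x i

theorem measurable_bits (n : ℕ) : Measurable (bits n : X → Fin n → Bool) :=
  measurable_pi_lambda _ fun _ =>
    (measurable_pi_apply _).comp (MeasurableSpace.measurable_mapNatBool X)

theorem bits_eq_of_le {m n : ℕ} (h : m ≤ n) {x y : X} (hxy : bits n x = bits n y) :
    bits m x = bits m y :=
  funext fun i => congrFun hxy (Fin.castLE h i)

theorem exists_bits_ne [MeasurableSpace.SeparatesPoints X] {x y : X} (h : x ≠ y) :
    ∃ n, bits n x ≠ bits n y := by
  obtain ⟨i, hi⟩ := Function.ne_iff.1 ((MeasurableSpace.injective_mapNatBool X).ne h)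
  exact ⟨i + 1, fun h' => hi (congrFun h' (Fin.last i))⟩

variable (X P) in
/-- The algebra of the sets in `X^P` that depend only on finitely many binary digits of the
coordinates. -/
def bitCylinders : Set (Set (P → X)) :=
  {E | ∃ (n : ℕ) (F : Set (P → Fin n → Bool)), E = (fun x p => bits n (x p)) ⁻¹' F}

theorem measurableSet_bits_preimage [Finite P] {n : ℕ} (F : Set (P → Fin n → Bool)) :
    MeasurableSet ((fun (x : P → X) p => bits n (x p)) ⁻¹' F) := by
  have h : Measurable fun (x : P → X) p => bits n (x p) :=
    measurable_pi_lambda _ fun p => (measurable_bits n).comp (measurable_pi_apply p)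
  exact h F.toFinite.measurableSet

theorem bits_preimage_eq_of_le {m n : ℕ} (h : m ≤ n) (F : Set (P → Fin m → Bool)) :
    (fun (x : P → X) p => bits m (x p)) ⁻¹' F =
      (fun x p => bits n (x p)) ⁻¹' ((fun z p i => z p (Fin.castLE h i)) ⁻¹' F) :=
  rfl

theorem isSetAlgebra_bitCylinders : IsSetAlgebra (bitCylinders X P) where
  empty_mem := ⟨0, ∅, rfl⟩
  compl_mem := by
    rintro - ⟨n, F, rfl⟩
    exact ⟨n, Fᶜ, rfl⟩
  union_mem := by
    rintro - - ⟨n, F, rfl⟩ ⟨m, F', rfl⟩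
    rw [bits_preimage_eq_of_le (le_max_left n m) F, bits_preimage_eq_of_le (le_max_right n m) F']
    exact ⟨max n m, _, preimage_union.symm⟩

theorem generateFrom_bitCylinders [Finite P] :
    (MeasurableSpace.pi : MeasurableSpace (P → X)) =
      MeasurableSpace.generateFrom (bitCylinders X P) := by
  refine le_antisymm (iSup_le fun p => ?_) (MeasurableSpace.generateFrom_le ?_)
  · refine (MeasurableSpace.comap_mono
      (MeasurableSpace.generateFrom_natGeneratingSequence X).ge).trans ?_
    rw [MeasurableSpace.comap_generateFrom]
    refine MeasurableSpace.generateFrom_mono ?_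
    rintro - ⟨-, ⟨i, rfl⟩, rfl⟩
    refine ⟨i + 1, {z | z p (Fin.last i) = true}, ?_⟩
    ext x
    simp [bits, MeasurableSpace.mapNatBool]
  · rintro - ⟨n, F, rfl⟩
    exact measurableSet_bits_preimage F

theorem tendsto_measure_not_injective_bits [MeasurableSpace.SeparatesPoints X] [Finite P]
    (A : Measure (P → X)) [IsFiniteMeasure A] (hA : ∀ a b : P, a ≠ b → A {x | x a = x b} = 0) :
    Tendsto (fun n => A {x | ¬ Function.Injective fun p => bits n (x p)}) atTop (𝓝 0) := by
  have hinter : A (⋂ n, {x : P → X | ¬ Function.Injective fun p => bits n (x p)}) = 0 := by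
    refine measure_mono_null (t := ⋃ q : {q : P × P // q.1 ≠ q.2}, {x | x q.1.1 = x q.1.2}) ?_
      (measure_iUnion_null fun q => hA _ _ q.2)
    intro x hx
    by_contra hne
    simp only [mem_iUnion, mem_ofPred_eq, not_exists] at hne
    choose N hN using fun q => exists_bits_ne (hne q)
    obtain ⟨n, hn⟩ := (finite_range N).bddAbove
    refine mem_iInter.1 hx n fun a b hab => ?_
    by_contra hq
    exact hN ⟨(a, b), hq⟩ (bits_eq_of_le (hn (mem_range_self _)) hab)
  rw [← hinter]
  exact tendsto_measure_iInter_atTop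
    (fun n => (measurableSet_bits_preimage
      {z : P → Fin n → Bool | ¬ Function.Injective z}).nullMeasurableSet)
    (fun m n hmn x hx hinj => hx fun p p' hp => hinj (bits_eq_of_le hmn hp))
    ⟨0, measure_ne_top _ _⟩

theorem exists_bits_preimage_measure_lt [Finite P] [Finite Q] {A : Measure (P → X)}
    {B : Measure (Q → X)} [IsFiniteMeasure A] [IsFiniteMeasure B] {R : Set (P ≃ Q)}
    (hR : ∀ r ∈ R, A ⟂ₘ B.map fun y p => y (r p)) {ε : ℝ≥0∞} (hε : 0 < ε) :
    ∃ (n : ℕ) (D : Set (P → Fin n → Bool)), A {x | (fun p => bits n (x p)) ∉ D} < ε ∧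
      B {y | ∃ r ∈ R, (fun p => bits n (y (r p))) ∈ D} < ε := by
  let B' : Measure (P → X) := Measure.sum fun r : R => B.map fun y p => y (r.1 p)
  obtain ⟨-, ⟨n, D, rfl⟩, hAD, hBD⟩ := exists_mem_measure_lt_of_mutuallySingular
    (Measure.MutuallySingular.sum_right.2 fun r : R => hR r r.2 : A ⟂ₘ B')
    isSetAlgebra_bitCylinders generateFrom_bitCylinders hε
  refine ⟨n, D, hAD, lt_of_le_of_lt ?_ hBD⟩
  have hD : MeasurableSet ((fun (x : P → X) p => bits n (x p)) ⁻¹' D) :=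
    measurableSet_bits_preimage D
  have hunion : {y : Q → X | ∃ r ∈ R, (fun p => bits n (y (r p))) ∈ D} =
      ⋃ r : R, {y | (fun p => bits n (y (r.1 p))) ∈ D} := by
    ext y
    simp
  rw [hunion, Measure.sum_apply _ hD]
  refine (measure_iUnion_le _).trans (ENNReal.tsum_le_tsum fun r => ?_)
  rw [Measure.map_apply (measurable_pi_lambda _ fun p => measurable_pi_apply _) hD]
  rfl

theorem exists_bits_separating [MeasurableSpace.SeparatesPoints X] [Finite P] [Finite Q]
    {A : Measure (P → X)} {B : Measure (Q → X)} [IsFiniteMeasure A] [IsFiniteMeasure B]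
    (hA : ∀ a b, a ≠ b → A {x | x a = x b} = 0) (hB : ∀ a b, a ≠ b → B {x | x a = x b} = 0)
    {R : Set (P ≃ Q)} (hR : ∀ r ∈ R, A ⟂ₘ B.map fun y p => y (r p)) {ε : ℝ≥0∞} (hε : 0 < ε) :
    ∃ (n : ℕ) (E : Set (P → X)) (F : Set (Q → X)), A Eᶜ < ε ∧ B Fᶜ < ε ∧
      (∀ x ∈ E, Function.Injective fun p => bits n (x p)) ∧
      (∀ y ∈ F, Function.Injective fun q => bits n (y q)) ∧
      ∀ x ∈ E, ∀ y ∈ F, ∀ r ∈ R, ∃ p, bits n (y (r p)) ≠ bits n (x p) := by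
  have hε2 : 0 < ε / 2 := ENNReal.half_pos hε.ne'
  obtain ⟨n₀, D, hAD, hBD⟩ := exists_bits_preimage_measure_lt hR hε2
  obtain ⟨n, hn₀, hnA, hnB⟩ := ((eventually_ge_atTop n₀).and
    (((tendsto_measure_not_injective_bits A hA).eventually_lt_const hε2).and
    ((tendsto_measure_not_injective_bits B hB).eventually_lt_const hε2))).exists
  refine ⟨n, {x | (fun p => bits n₀ (x p)) ∈ D} ∩ {x | Function.Injective fun p => bits n (x p)},
    {y | ∃ r ∈ R, (fun p => bits n₀ (y (r p))) ∈ D}ᶜ ∩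
      {y | Function.Injective fun q => bits n (y q)},
    measure_compl_inter_lt hAD hnA, measure_compl_inter_lt (by rwa [compl_compl]) hnB,
    fun _ hx => hx.2, fun _ hy => hy.2, ?_⟩
  rintro x ⟨hx, -⟩ y ⟨hy, -⟩ r hr
  by_contra! hxy
  have hbits : (fun p => bits n₀ (y (r p))) = fun p => bits n₀ (x p) :=
    funext fun p => bits_eq_of_le hn₀ (hxy p)
  exact hy ⟨r, hr, hbits ▸ hx⟩

end Bits

/-! ### Generic singularity of images -/

section Generic

variable {X : Type*} [MeasurableSpace X]

theorem exists_simpleFunc_dist_lt {Z : Type*} [PseudoMetricSpace Z] [CompactSpace Z] [Nonempty Z]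
    [MeasurableSpace Z] [OpensMeasurableSpace Z] {f : X → Z} (hf : Measurable f) {δ : ℝ}
    (hδ : 0 < δ) : ∃ s : SimpleFunc X Z, ∀ x, dist (s x) (f x) < δ := by
  let e := TopologicalSpace.denseSeq Z
  obtain ⟨t, ht⟩ := isCompact_univ.elim_finite_subcover (fun n => Metric.ball (e n) δ)
    (fun _ => Metric.isOpen_ball) fun z _ =>
      mem_iUnion.2 ((TopologicalSpace.denseRange_denseSeq Z).exists_dist_lt z hδ)
  refine ⟨(SimpleFunc.nearestPt e (t.sup id)).comp f hf, fun x => ?_⟩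
  obtain ⟨n, hn, hx⟩ := mem_iUnion₂.1 (ht (mem_univ (f x)))
  rw [← edist_lt_ofReal]
  refine (SimpleFunc.edist_nearestPt_le e (f x) (Finset.le_sup (f := id) hn)).trans_lt ?_
  rwa [edist_lt_ofReal, dist_comm]

variable {μ : Measure X} [IsFiniteMeasure μ]

theorem dist_le_of_ae_dist_le {f g : X →ₘ[μ] Circle} {η : ℝ} (h : ∀ᵐ x ∂μ, dist (f x) (g x) ≤ η) :
    dist f g ≤ η * μ.real univ := by
  calc dist f g = ∫ x, ‖(f x : ℂ) - (g x : ℂ)‖ ∂μ := rfl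
    _ ≤ ∫ _, η ∂μ := integral_mono_ae (integrable_norm_sub f g) (integrable_const _)
        (h.mono fun x hx => (dist_eq_norm (f x : ℂ) (g x)).ge.trans hx)
    _ = η * μ.real univ := by rw [integral_const, smul_eq_mul, mul_comm]

theorem exists_linearIndependent_dist_lt {D : Type*} [Finite D] [MeasurableSpace D]
    [MeasurableSingletonClass D] {b : X → D} (hb : Measurable b) (f₀ : X →ₘ[μ] Circle) {δ : ℝ}
    (hδ : 0 < δ) : ∃ (t : Finset Circle) (c : D × t → Circle) (m : X → t) (f : X →ₘ[μ] Circle),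
      LinearIndependent ℤ (fun j => Additive.ofMul (c j)) ∧ f =ᵐ[μ] (fun x => c (b x, m x)) ∧
      dist f₀ f < δ := by
  have := Fintype.ofFinite D
  have hM : 0 < μ.real univ + 1 := by positivity
  set η := δ / (μ.real univ + 1)
  have hη : 0 < η / 2 := by positivity
  obtain ⟨s, hs⟩ := exists_simpleFunc_dist_lt f₀.measurable hη
  obtain ⟨c, hc, hcs⟩ := (dense_linearIndependent_circle (D × s.range)).exists_dist_lt
    (fun j => (j.2 : Circle)) hη
  let m (x : X) : s.range := ⟨s x, s.mem_range_self x⟩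
  have hF : Measurable fun x => c (b x, m x) :=
    (measurable_of_finite c).comp (hb.prodMk s.measurable.subtype_mk)
  refine ⟨s.range, c, m, AEEqFun.mk _ hF.aestronglyMeasurable, hc, AEEqFun.coeFn_mk _ _, ?_⟩
  have hdist : dist f₀ (AEEqFun.mk _ hF.aestronglyMeasurable) ≤ η * μ.real univ := by
    refine dist_le_of_ae_dist_le ?_
    filter_upwards [AEEqFun.coeFn_mk _ hF.aestronglyMeasurable] with x hx
    calc dist (f₀ x) _ ≤ dist (s x) (f₀ x) + dist (s x) (c (b x, m x)) := by
          rw [hx]; exact dist_triangle_left _ _ _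
      _ ≤ η / 2 + η / 2 := add_le_add (hs x).le ((dist_le_pi_dist _ c (b x, m x)).trans hcs.le)
      _ = η := add_halves η
  calc dist f₀ _ ≤ η * μ.real univ := hdist
    _ < η * (μ.real univ + 1) := by gcongr; exact lt_add_one _
    _ = δ := div_mul_cancel₀ δ hM.ne'

variable {P Q : Type*} [Fintype P] [Fintype Q] {α : P → ℤ} {β : Q → ℤ}

variable [MeasurableSpace.CountablyGenerated X] [MeasurableSpace.SeparatesPoints X]
  {A : Measure (P → X)} {B : Measure (Q → X)} [IsFiniteMeasure A] [IsFiniteMeasure B]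

theorem dense_setOf_almostSeparated_map_evalPow (hα : ∀ p, α p ≠ 0) (hβ : ∀ q, β q ≠ 0)
    (hA : ∀ p, A.map (fun x => x p) ≪ μ) (hB : ∀ q, B.map (fun x => x q) ≪ μ)
    (hA' : ∀ a b, a ≠ b → A {x | x a = x b} = 0) (hB' : ∀ a b, a ≠ b → B {x | x a = x b} = 0)
    (hr : ∀ r : P ≃ Q, (∀ p, α p = β (r p)) → A ⟂ₘ B.map fun y p => y (r p))
    {ε : ℝ≥0∞} (hε : 0 < ε) :
    Dense {f : X →ₘ[μ] Circle |
      AlmostSeparated ε (A.map (evalPow f α)) (B.map (evalPow f β))} := by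
  intro f₀
  refine Metric.mem_closure_iff.2 fun δ hδ => ?_
  obtain ⟨n, E, F, hE, hF, hEinj, hFinj, hEF⟩ :=
    exists_bits_separating hA' hB' (R := {r | ∀ p, α p = β (r p)}) hr hε
  obtain ⟨t, c, m, f, hc, hfc, hf⟩ := exists_linearIndependent_dist_lt (measurable_bits n) f₀ hδ
  refine ⟨f, ?_, hf⟩
  let q (x : X) : (Fin n → Bool) × t := (bits n x, m x)
  have hfq : f =ᵐ[μ] c ∘ q := hfc
  have hS : (evalPow (c ∘ q) α '' E).Finite :=
    (finite_range_evalPow_comp c q α).subset (image_subset_range _ _)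
  have hT : (evalPow (c ∘ q) β '' F).Finite :=
    (finite_range_evalPow_comp c q β).subset (image_subset_range _ _)
  have hdisj : Disjoint (evalPow (c ∘ q) α '' E) (evalPow (c ∘ q) β '' F) := by
    refine disjoint_left.2 ?_
    rintro - ⟨x, hx, rfl⟩ ⟨y, hy, hxy⟩
    have hx' : Function.Injective (q ∘ x) := .of_comp (f := Prod.fst) (hEinj x hx)
    have hy' : Function.Injective (q ∘ y) := .of_comp (f := Prod.fst) (hFinj y hy)
    obtain ⟨r, hrq, hr⟩ := exists_equiv_of_evalPow_comp_eq hc hα hβ hx' hy' hxy.symm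
    obtain ⟨p, hp⟩ := hEF x hx y hy r hr
    exact hp (congrArg Prod.fst (hrq p))
  exact .of_disjoint_isClosed hS.isClosed hT.isClosed hdisj
    ((measure_map_compl_image_le (measurable_evalPow f.measurable α)
      (evalPow_congr_ae hA hfq α) hS.measurableSet).trans_lt hE)
    ((measure_map_compl_image_le (measurable_evalPow f.measurable β)
      (evalPow_congr_ae hB hfq β) hT.measurableSet).trans_lt hF)

theorem eventually_residual_mutuallySingular (hα : ∀ p, α p ≠ 0) (hβ : ∀ q, β q ≠ 0)
    (hA : ∀ p, A.map (fun x => x p) ≪ μ) (hB : ∀ q, B.map (fun x => x q) ≪ μ)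
    (hA' : ∀ a b, a ≠ b → A {x | x a = x b} = 0) (hB' : ∀ a b, a ≠ b → B {x | x a = x b} = 0)
    (hr : ∀ r : P ≃ Q, (∀ p, α p = β (r p)) → A ⟂ₘ B.map fun y p => y (r p)) :
    ∀ᶠ f : X →ₘ[μ] Circle in residual (X →ₘ[μ] Circle),
      A.map (evalPow f α) ⟂ₘ B.map (evalPow f β) := by
  have hsep (n : ℕ) : ∀ᶠ f : X →ₘ[μ] Circle in residual (X →ₘ[μ] Circle),
      AlmostSeparated (n : ℝ≥0∞)⁻¹ (A.map (evalPow f α)) (B.map (evalPow f β)) :=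
    residual_of_dense_open (isOpen_setOf_almostSeparated_map_evalPow hA hB α β _)
      (dense_setOf_almostSeparated_map_evalPow hα hβ hA hB hA' hB' hr (by simp))
  filter_upwards [eventually_countable_forall.2 hsep] with f hf
  refine mutuallySingular_of_forall_almostSeparated fun ε hε => ?_
  obtain ⟨n, hn⟩ := ENNReal.exists_inv_nat_lt hε.ne'
  exact (hf n).mono hn.le

end Generic

/-! ### Coordinates of the product measures -/

theorem measurableEq_of_separatesPoints (X : Type*) [MeasurableSpace X]
    [MeasurableSpace.CountablyGenerated X] [MeasurableSpace.SeparatesPoints X] :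
    MeasurableEq X where
  measurableSet_diagonal := by
    have hdiag : diagonal X = {p | MeasurableSpace.mapNatBool X p.1 =
        MeasurableSpace.mapNatBool X p.2} :=
      ext fun p => (MeasurableSpace.injective_mapNatBool X).eq_iff.symm
    have hmeas := MeasurableSpace.measurable_mapNatBool X
    rw [hdiag]
    exact measurableSet_eq_fun (hmeas.comp measurable_fst) (hmeas.comp measurable_snd)

theorem measure_pi_coincidence_eq_zero {X ι : Type*} [MeasurableSpace X] [MeasurableEq X]
    [Fintype ι] {Y : ι → Type*} [∀ i, MeasurableSpace (Y i)] (τ : ∀ i, Measure (Y i))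
    [∀ i, SigmaFinite (τ i)] {i j : ι} (hij : i ≠ j) {φ : Y i → X} {ψ : Y j → X}
    (hφ : Measurable φ) (hψ : Measurable ψ) (h : ∀ z, τ i (φ ⁻¹' {z}) = 0) :
    Measure.pi τ {y | φ (y i) = ψ (y j)} = 0 := by
  classical
  have hmeas : MeasurableSet
      {w : (∀ a : {a // a ≠ j}, Y a) × (∀ a : {a // ¬ a ≠ j}, Y a) |
        φ (w.1 ⟨i, hij⟩) = ψ (w.2 ⟨j, not_not.2 rfl⟩)} :=
    measurableSet_eq_fun (hφ.comp ((measurable_pi_apply _).comp measurable_fst))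
      (hψ.comp ((measurable_pi_apply _).comp measurable_snd))
  refine ((measurePreserving_piEquivPiSubtypeProd τ (· ≠ j)).measure_preimage
    hmeas.nullMeasurableSet).trans ?_
  rw [Measure.prod_apply_symm hmeas]
  refine (lintegral_congr fun v => ?_).trans lintegral_zero
  exact Measure.pi_eval_preimage_null (fun a : {a // a ≠ j} => τ a) (i := ⟨i, hij⟩)
    (h (ψ (v ⟨j, not_not.2 rfl⟩)))

section ProdMeasure

variable {X : Type*} [MeasurableSpace X] {μ : Measure X}
  {lam : (κ : Weight) → ℕ+ → Measure (Fin κ.len → X)} {l : ℕ}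

theorem measurable_uncurry_pi (κ : Fin l → Weight) :
    Measurable fun (y : ∀ i, Fin (κ i).len → X) (p : ConcatIndex κ) => y p.1 p.2 :=
  measurable_pi_lambda _ fun p => (measurable_pi_apply p.2).comp (measurable_pi_apply p.1)

theorem isFiniteMeasure_prodMeasure (hlam : ∀ κ, IsFiniteMeasure (lam κ 1)) (κ : Fin l → Weight) :
    IsFiniteMeasure (prodMeasure lam κ) := by
  unfold prodMeasure
  infer_instance

variable (hlam : IsSoleckiFamily μ lam)
include hlam

theorem prodMeasure_marginal (κ : Fin l → Weight) (p : ConcatIndex κ) :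
    (prodMeasure lam κ).map (fun x => x p) ≪ μ := by
  have := hlam.finite
  have heval : (prodMeasure lam κ).map (fun x => x p) =
      ((Measure.pi fun i => lam (κ i) 1).map (Function.eval p.1)).map fun x => x p.2 := by
    rw [prodMeasure, Measure.map_map (measurable_pi_apply _) (measurable_uncurry_pi κ),
      Measure.map_map (measurable_pi_apply _) (measurable_pi_apply _)]
    rfl
  rw [heval]
  have hpi := (Measure.quasiMeasurePreserving_eval (fun i => lam (κ i) 1) p.1).absolutelyContinuous
  exact (hpi.map (measurable_pi_apply p.2)).trans (hlam.marginal _ _ _)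

theorem prodMeasure_diagonal [MeasurableEq X] [NullSingletonClass μ] (κ : Fin l → Weight)
    {p q : ConcatIndex κ} (hpq : p ≠ q) : prodMeasure lam κ {x | x p = x q} = 0 := by
  have := hlam.finite
  rw [prodMeasure, Measure.map_apply (measurable_uncurry_pi κ)
    (measurableSet_eq_fun (measurable_pi_apply p) (measurable_pi_apply q))]
  obtain ⟨i, a⟩ := p
  obtain ⟨j, b⟩ := q
  by_cases hij : i = j
  · subst hij
    have hab : lam (κ i) 1 {x | x a = x b} = 0 := by
      rcases lt_or_gt_of_ne fun hab => hpq (congrArg _ hab) with hab | hab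
      · exact hlam.diagonal _ _ _ _ hab
      · simpa only [eq_comm] using hlam.diagonal (κ i) 1 _ _ hab
    exact Measure.pi_eval_preimage_null (fun i => lam (κ i) 1) hab
  · refine measure_pi_coincidence_eq_zero (fun i => lam (κ i) 1) hij (measurable_pi_apply a)
      (measurable_pi_apply b) fun z => ?_
    rw [← Measure.map_apply (measurable_pi_apply a) (measurableSet_singleton z)]
    exact hlam.marginal (κ i) 1 a (measure_singleton z)

end ProdMeasure

/-! ### Spectral measures of multiplication operators -/

section NormSqMeasure

variable {Y E : Type*} [MeasurableSpace Y] {ρ : Measure Y} [NormedAddCommGroup E]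

/-- The measure `‖h‖² dρ` of total mass `‖h‖²` attached to a square-integrable function `h`. -/
noncomputable def normSqMeasure (h : Lp E 2 ρ) : Measure Y :=
  ρ.withDensity fun y => ‖h y‖ₑ ^ 2

theorem measurable_enorm_sq (h : Lp E 2 ρ) : Measurable fun y => ‖h y‖ₑ ^ 2 :=
  (Lp.stronglyMeasurable h).enorm.pow_const 2

theorem normSqMeasure_univ (h : Lp E 2 ρ) : normSqMeasure h univ = ‖h‖ₑ ^ 2 := by
  have hnorm := eLpNorm_nnreal_pow_eq_lintegral (f := h) (μ := ρ) (p := 2) two_ne_zero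
  rw [normSqMeasure, withDensity_apply _ MeasurableSet.univ, Measure.restrict_univ, Lp.enorm_def]
  simpa using hnorm.symm

theorem normSqMeasure_absolutelyContinuous (h : Lp E 2 ρ) : normSqMeasure h ≪ ρ :=
  withDensity_absolutelyContinuous _ _

theorem absolutelyContinuous_normSqMeasure {h : Lp E 2 ρ} (hh : ∀ᵐ y ∂ρ, h y ≠ 0) :
    ρ ≪ normSqMeasure h := by
  refine withDensity_absolutelyContinuous' (measurable_enorm_sq h).aemeasurable ?_
  filter_upwards [hh] with y hy
  simpa using hy

theorem integral_normSqMeasure [InnerProductSpace ℂ E] (h : Lp E 2 ρ) (φ : Y → ℂ) :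
    ∫ y, φ y ∂normSqMeasure h = ∫ y, φ y * inner ℂ (h y) (h y) ∂ρ := by
  rw [normSqMeasure, integral_withDensity_eq_integral_toReal_smul (measurable_enorm_sq h)
    (.of_forall fun y => by simp)]
  refine integral_congr_ae (.of_forall fun y => ?_)
  simp [inner_self_eq_norm_sq_to_K, mul_comm]

end NormSqMeasure

section Spectral

variable {H : Type*} [NormedAddCommGroup H] [InnerProductSpace ℂ H] [CompleteSpace H]
  {u : unitary (H →L[ℂ] H)}

theorem IsSpectralMeasure.unique {v : H} {σ τ : Measure Circle} (hσ : IsSpectralMeasure u v σ)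
    (hτ : IsSpectralMeasure u v τ) : σ = τ := by
  have := hσ.1
  have := hτ.1
  exact circle_measure_ext fun n => (hσ.2 n).symm.trans (hτ.2 n)

variable {ι : Type*} {Y : ι → Type*} [∀ i, MeasurableSpace (Y i)] {ρ : ∀ i, Measure (Y i)}
  {U : H ≃ₗᵢ[ℂ] lp (fun i => Lp ℂ 2 (ρ i)) 2} {m : ∀ i, Y i → Circle}

/-- The isometry `U` carries the unitary operator `u` to multiplication by the circle-valued
function `m i` in the summand `L²(ρ i)`. -/
def IsMultiplicationBy (U : H ≃ₗᵢ[ℂ] lp (fun i => Lp ℂ 2 (ρ i)) 2) (u : unitary (H →L[ℂ] H))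
    (m : ∀ i, Y i → Circle) : Prop :=
  ∀ v i, ⇑(U ((u : H →L[ℂ] H) v) i) =ᵐ[ρ i] fun y => (m i y : ℂ) * (U v i : Y i → ℂ) y

theorem IsMultiplicationBy.one : IsMultiplicationBy U 1 1 := fun v i =>
  .of_forall fun y => by simp

theorem IsMultiplicationBy.mul {u' : unitary (H →L[ℂ] H)} {m' : ∀ i, Y i → Circle}
    (h : IsMultiplicationBy U u m) (h' : IsMultiplicationBy U u' m') :
    IsMultiplicationBy U (u * u') (m * m') := fun v i => by
  filter_upwards [h ((u' : H →L[ℂ] H) v) i, h' v i] with y hy hy'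
  rw [Submonoid.coe_mul, mul_apply_eq_comp, hy, hy']
  simp [mul_assoc]

theorem IsMultiplicationBy.inv (h : IsMultiplicationBy U u m) :
    IsMultiplicationBy U u⁻¹ m⁻¹ := fun v i => by
  have hv : (u : H →L[ℂ] H) (((u⁻¹ : unitary (H →L[ℂ] H)) : H →L[ℂ] H) v) = v := by
    rw [← mul_apply_eq_comp, ← Submonoid.coe_mul, mul_inv_cancel]
    rfl
  filter_upwards [h (((u⁻¹ : unitary (H →L[ℂ] H)) : H →L[ℂ] H) v) i] with y hy
  rw [hv] at hy
  simp [hy]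

theorem IsMultiplicationBy.zpow (h : IsMultiplicationBy U u m) (k : ℤ) :
    IsMultiplicationBy U (u ^ k) (m ^ k) :=
  let S : Subgroup (unitary (H →L[ℂ] H) × ∀ i, Y i → Circle) :=
    { carrier := {a | IsMultiplicationBy U a.1 a.2}
      one_mem' := .one
      mul_mem' := .mul
      inv_mem' := .inv }
  S.zpow_mem (x := (u, m)) h k

theorem isFiniteMeasure_sum_map_normSqMeasure (w : lp (fun i => Lp ℂ 2 (ρ i)) 2)
    (hm : ∀ i, Measurable (m i)) :
    IsFiniteMeasure (Measure.sum fun i => (normSqMeasure (w i)).map (m i)) := by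
  refine ⟨?_⟩
  have hmass (i : ι) : (normSqMeasure (w i)).map (m i) univ = ENNReal.ofReal (‖w i‖ ^ 2) := by
    rw [Measure.map_apply (hm i) MeasurableSet.univ, preimage_univ, normSqMeasure_univ,
      ENNReal.ofReal_pow (norm_nonneg _), ofReal_norm]
  have hsum : Summable fun i => ‖w i‖ ^ 2 := by
    simpa using (lp.memℓp w).summable (by norm_num)
  rw [Measure.sum_apply _ MeasurableSet.univ]
  simp_rw [hmass]
  exact hsum.tsum_ofReal_lt_top

theorem IsMultiplicationBy.isSpectralMeasure (h : IsMultiplicationBy U u m)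
    (hm : ∀ i, Measurable (m i)) (v : H) :
    IsSpectralMeasure u v (Measure.sum fun i => (normSqMeasure (U v i)).map (m i)) := by
  have hfin := isFiniteMeasure_sum_map_normSqMeasure (U v) hm
  refine ⟨hfin, fun n => ?_⟩
  have hcont : Continuous fun z : Circle => (z : ℂ) ^ n := by
    simp only [← Circle.coe_zpow]
    exact continuous_subtype_val.comp (continuous_zpow n)
  have hint : Integrable (fun z : Circle => (z : ℂ) ^ n)
      (Measure.sum fun i => (normSqMeasure (U v i)).map (m i)) :=
    .of_bound hcont.aestronglyMeasurable 1
      (.of_forall fun z => by rw [norm_zpow, Circle.norm_coe, one_zpow])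
  rw [← U.inner_map_map]
  refine (lp.hasSum_inner _ _).unique ((hasSum_integral_measure hint).congr_fun fun i => ?_)
  rw [integral_map (hm i).aemeasurable hcont.aestronglyMeasurable, integral_normSqMeasure,
    L2.inner_def]
  refine integral_congr_ae ?_
  filter_upwards [h.zpow n v i] with y hy
  rw [hy, RCLike.inner_apply, RCLike.inner_apply, mul_assoc, Pi.pow_apply, Pi.pow_apply,
    Circle.coe_zpow]

theorem exists_pos_memℓp_smul [Countable ι] {E : ι → Type*} [∀ i, NormedAddCommGroup (E i)]
    [∀ i, NormedSpace ℝ (E i)] (e : ∀ i, E i) :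
    ∃ t : ι → ℝ, (∀ i, 0 < t i) ∧ Memℓp (fun i => t i • e i) 1 := by
  obtain ⟨δ, hδ, _, hsum, -⟩ := NNReal.exists_pos_sum_of_countable one_ne_zero ι
  have hδ' (i : ι) : 0 < (δ i : ℝ) := hδ i
  have hpos (i : ι) : 0 < 1 + ‖e i‖ := by positivity
  refine ⟨fun i => δ i / (1 + ‖e i‖), fun i => div_pos (hδ' i) (hpos i), memℓp_gen ?_⟩
  simp only [ENNReal.toReal_one, Real.rpow_one]
  refine .of_nonneg_of_le (fun i => norm_nonneg _) (fun i => ?_)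
    (NNReal.summable_coe.2 hsum.summable)
  rw [norm_smul, Real.norm_of_nonneg (div_pos (hδ' i) (hpos i)).le, div_mul_eq_mul_div,
    div_le_iff₀ (hpos i)]
  gcongr
  exact le_add_of_nonneg_left zero_le_one

theorem exists_lp_forall_ae_ne_zero [Countable ι] (ρ : ∀ i, Measure (Y i))
    [∀ i, IsFiniteMeasure (ρ i)] :
    ∃ w : lp (fun i => Lp ℂ 2 (ρ i)) 2, ∀ i, ∀ᵐ y ∂ρ i, w i y ≠ 0 := by
  obtain ⟨t, ht, hmem⟩ := exists_pos_memℓp_smul fun i => Lp.const 2 (ρ i) (1 : ℂ)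
  refine ⟨⟨_, hmem.of_exponent_ge one_le_two⟩, fun i => ?_⟩
  filter_upwards [Lp.coeFn_smul (t i) (Lp.const 2 (ρ i) (1 : ℂ)),
    Lp.coeFn_const 2 (ρ i) (1 : ℂ)] with y hsmul hconst
  rw [hsmul, Pi.smul_apply, hconst]
  simpa using (ht i).ne'

theorem IsMaximalSpectralType.absolutelyContinuous_sum_map {σ : Measure Circle}
    (hσ : IsMaximalSpectralType u σ) (h : IsMultiplicationBy U u m) (hm : ∀ i, Measurable (m i)) :
    σ ≪ Measure.sum fun i => (ρ i).map (m i) := by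
  obtain ⟨⟨v, hv⟩, -⟩ := hσ
  rw [hv.unique (h.isSpectralMeasure hm v)]
  exact Measure.absolutelyContinuous_sum_left fun i => Measure.absolutelyContinuous_sum_right i
    ((normSqMeasure_absolutelyContinuous _).map (hm i))

variable [Countable ι] [∀ i, IsFiniteMeasure (ρ i)]

theorem IsMaximalSpectralType.map_absolutelyContinuous {σ : Measure Circle}
    (hσ : IsMaximalSpectralType u σ) (h : IsMultiplicationBy U u m) (hm : ∀ i, Measurable (m i))
    (i : ι) : (ρ i).map (m i) ≪ σ := by
  obtain ⟨w, hw⟩ := exists_lp_forall_ae_ne_zero ρ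
  refine .trans ?_ (hσ.2 (U.symm w) _ (h.isSpectralMeasure hm _))
  rw [U.apply_symm_apply]
  exact Measure.absolutelyContinuous_sum_right i
    ((absolutelyContinuous_normSqMeasure (hw i)).map (hm i))

theorem IsMultiplicationBy.exists_isMaximalSpectralType (h : IsMultiplicationBy U u m)
    (hm : ∀ i, Measurable (m i)) : ∃ σ, IsMaximalSpectralType u σ := by
  obtain ⟨w, hw⟩ := exists_lp_forall_ae_ne_zero ρ
  refine ⟨_, ⟨U.symm w, h.isSpectralMeasure hm _⟩, fun v τ hτ => ?_⟩
  rw [hτ.unique (h.isSpectralMeasure hm v), U.apply_symm_apply]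
  exact Measure.absolutelyContinuous_sum_left fun i => Measure.absolutelyContinuous_sum_right i
    (((normSqMeasure_absolutelyContinuous _).trans
      (absolutelyContinuous_normSqMeasure (hw i))).map (hm i))

end Spectral

/-! ### Convolutions of maximal spectral types -/

instance Weight.instCountable : Countable Weight := by
  refine Function.Injective.countable
    (f := fun κ : Weight => (⟨κ.len, κ.entry⟩ : Σ n, Fin n → ℤ)) ?_
  rintro ⟨n, hn, e, he, hmono⟩ ⟨n', hn', e', he', hmono'⟩ h
  obtain ⟨rfl, h⟩ := Sigma.mk.inj h
  obtain rfl := eq_of_heq h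
  rfl

section Convolution

variable {l l' : ℕ}

theorem measurable_finProd (l : ℕ) : Measurable fun z : Fin l → Circle => ∏ i, z i :=
  (continuous_finsetProd _ fun i _ => continuous_apply i).measurable

theorem convolution_absolutelyContinuous {σ τ : Fin l → Measure Circle} [∀ i, SigmaFinite (σ i)]
    [∀ i, SigmaFinite (τ i)] (h : ∀ i, σ i ≪ τ i) : convolution σ ≪ convolution τ :=
  (pi_absolutelyContinuous h).map (measurable_finProd l)

theorem convolution_absolutelyContinuous_sum {W : Type*} [Countable W]
    {σ : Fin l → Measure Circle} {τ : Fin l → W → Measure Circle} [∀ i, SigmaFinite (σ i)]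
    [∀ i w, SigmaFinite (τ i w)] (h : ∀ i, σ i ≪ Measure.sum (τ i)) :
    convolution σ ≪ Measure.sum fun p : Fin l → W => convolution fun i => τ i (p i) := by
  have hmap := (pi_absolutelyContinuous_sum h).map (measurable_finProd l)
  rwa [Measure.map_sum (measurable_finProd l).aemeasurable] at hmap

theorem mutuallySingular_convolution_iff {W : Type*} [Countable W]
    {σ : Fin l → Measure Circle} {τ : Fin l → W → Measure Circle}
    {σ' : Fin l' → Measure Circle} {τ' : Fin l' → W → Measure Circle}
    [∀ i, SigmaFinite (σ i)] [∀ i w, SigmaFinite (τ i w)]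
    [∀ j, SigmaFinite (σ' j)] [∀ j w, SigmaFinite (τ' j w)]
    (hσ : ∀ i, σ i ≪ Measure.sum (τ i)) (hτ : ∀ i w, τ i w ≪ σ i)
    (hσ' : ∀ j, σ' j ≪ Measure.sum (τ' j)) (hτ' : ∀ j w, τ' j w ≪ σ' j) :
    convolution σ ⟂ₘ convolution σ' ↔
      ∀ (p : Fin l → W) (p' : Fin l' → W),
        (convolution fun i => τ i (p i)) ⟂ₘ convolution fun j => τ' j (p' j) := by
  refine ⟨fun h p p' => h.mono_ac (convolution_absolutelyContinuous fun i => hτ i (p i))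
    (convolution_absolutelyContinuous fun j => hτ' j (p' j)), fun h => ?_⟩
  refine Measure.MutuallySingular.mono_ac ?_ (convolution_absolutelyContinuous_sum hσ)
    (convolution_absolutelyContinuous_sum hσ')
  exact Measure.MutuallySingular.sum_left.2 fun p => Measure.MutuallySingular.sum_right.2 (h p)

end Convolution

section WeightMeasure

variable {X : Type*} [MeasurableSpace X] {lam : (κ : Weight) → ℕ+ → Measure (Fin κ.len → X)}

/-- The image of `λ_κ^1` under `f^{kκ} = (f^κ)^k`. The maximal spectral type of `Φ(f)^k` is the sum
of these measures over `κ`, up to mutual absolute continuity. -/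
noncomputable def weightMeasure (lam : (κ : Weight) → ℕ+ → Measure (Fin κ.len → X))
    (f : X → Circle) (k : ℤ) (κ : Weight) : Measure Circle :=
  (lam κ 1).map fun x => evalPow f κ.entry x ^ k

theorem measurable_evalPow_zpow {P : Type*} [Fintype P] {f : X → Circle} (hf : Measurable f)
    (α : P → ℤ) (k : ℤ) : Measurable fun x => evalPow f α x ^ k :=
  (continuous_zpow k).measurable.comp (measurable_evalPow hf α)

theorem isFiniteMeasure_weightMeasure (hlam : ∀ κ, IsFiniteMeasure (lam κ 1)) (f : X → Circle)
    (k : ℤ) (κ : Weight) : IsFiniteMeasure (weightMeasure lam f k κ) := by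
  unfold weightMeasure
  infer_instance

theorem convolution_weightMeasure (hlam : ∀ κ, IsFiniteMeasure (lam κ 1)) {f : X → Circle}
    (hf : Measurable f) {l : ℕ} (k : Fin l → ℤ) (κ : Fin l → Weight) :
    (convolution fun i => weightMeasure lam f (k i) (κ i)) =
      (prodMeasure lam κ).map (evalPow f (concat k κ)) := by
  have hpow (i : Fin l) := measurable_evalPow_zpow hf (κ i).entry (k i)
  have hpows : Measurable fun (y : ∀ i, Fin (κ i).len → X) i => evalPow f (κ i).entry (y i) ^ k i :=
    measurable_pi_lambda _ fun i => (hpow i).comp (measurable_pi_apply i)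
  unfold convolution weightMeasure prodMeasure
  rw [← Measure.pi_map_pi fun i => (hpow i).aemeasurable,
    Measure.map_map (measurable_finProd l) hpows,
    Measure.map_map (measurable_evalPow hf _) (measurable_uncurry_pi κ)]
  congr 1
  funext y
  simp only [Function.comp_apply, evalPow, concat, Fintype.prod_sigma, ← Finset.prod_zpow,
    ← zpow_mul, mul_comm]

end WeightMeasure

section DirectSum

variable {X : Type*} [MeasurableSpace X] {μ : Measure X}
  {H : Type*} [NormedAddCommGroup H] [InnerProductSpace ℂ H] [CompleteSpace H]
  {Φ : (X →ₘ[μ] Circle) →* unitary (H →L[ℂ] H)}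
  {lam : (κ : Weight) → ℕ+ → Measure (Fin κ.len → X)}

theorem IsDirectSumOfMultiplications.exists_isMultiplicationBy_zpow
    (hsum : IsDirectSumOfMultiplications Φ lam) :
    ∃ U : H ≃ₗᵢ[ℂ] lp (fun p : Weight × ℕ+ => Lp ℂ 2 (lam p.1 p.2)) 2,
      ∀ f (k : ℤ), IsMultiplicationBy U (Φ f ^ k) fun p x => evalPow f p.1.entry x ^ k := by
  obtain ⟨U, hU⟩ := hsum
  refine ⟨U, fun f k => ?_⟩
  have hf : IsMultiplicationBy U (Φ f) fun p => evalPow f p.1.entry := fun v p => hU f v p.1 p.2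
  exact hf.zpow k

variable (hlam : IsSoleckiFamily μ lam) (hsum : IsDirectSumOfMultiplications Φ lam)
include hlam hsum

theorem exists_isMaximalSpectralType_zpow (f : X →ₘ[μ] Circle) (k : ℤ) :
    ∃ σ, IsMaximalSpectralType (Φ f ^ k) σ := by
  have := hlam.finite
  obtain ⟨U, hU⟩ := hsum.exists_isMultiplicationBy_zpow
  exact (hU f k).exists_isMaximalSpectralType fun p => measurable_evalPow_zpow f.measurable _ k

variable {f : X →ₘ[μ] Circle}

theorem weightMeasure_absolutelyContinuous {k : ℤ} {σ : Measure Circle}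
    (hσ : IsMaximalSpectralType (Φ f ^ k) σ) (κ : Weight) : weightMeasure lam f k κ ≪ σ := by
  have := hlam.finite
  obtain ⟨U, hU⟩ := hsum.exists_isMultiplicationBy_zpow
  exact hσ.map_absolutelyContinuous (hU f k)
    (fun p => measurable_evalPow_zpow f.measurable _ k) (κ, 1)

theorem absolutelyContinuous_sum_weightMeasure {k : ℤ} {σ : Measure Circle}
    (hσ : IsMaximalSpectralType (Φ f ^ k) σ) : σ ≪ Measure.sum (weightMeasure lam f k) := by
  obtain ⟨U, hU⟩ := hsum.exists_isMultiplicationBy_zpow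
  have hmeas (κ : Weight) := measurable_evalPow_zpow f.measurable κ.entry k
  refine (hσ.absolutelyContinuous_sum_map (hU f k) fun p => hmeas p.1).trans
    (Measure.absolutelyContinuous_sum_left fun p => Measure.absolutelyContinuous_sum_right p.1 ?_)
  have hfirst : lam p.1 p.2 ≪ lam p.1 1 := by
    rcases eq_or_lt_of_le (one_le (a := p.2)) with h | h
    · rw [← h]
    · exact hlam.decreasing _ _ _ h
  exact hfirst.map (hmeas p.1)

theorem mutuallySingular_convolution_isMaximalSpectralType_iff {l l' : ℕ} {k : Fin l → ℤ}
    {k' : Fin l' → ℤ} {σ : Fin l → Measure Circle} {σ' : Fin l' → Measure Circle}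
    (hσ : ∀ i, IsMaximalSpectralType (Φ f ^ k i) (σ i))
    (hσ' : ∀ j, IsMaximalSpectralType (Φ f ^ k' j) (σ' j)) :
    convolution σ ⟂ₘ convolution σ' ↔
      ∀ κ κ', (prodMeasure lam κ).map (evalPow f (concat k κ)) ⟂ₘ
        (prodMeasure lam κ').map (evalPow f (concat k' κ')) := by
  have hlam' (κ : Weight) := hlam.finite κ 1
  have hfin (i : Fin l) : IsFiniteMeasure (σ i) := (hσ i).1.choose_spec.1
  have hfin' (j : Fin l') : IsFiniteMeasure (σ' j) := (hσ' j).1.choose_spec.1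
  have := isFiniteMeasure_weightMeasure hlam' f
  simp only [← convolution_weightMeasure hlam' f.measurable]
  exact mutuallySingular_convolution_iff
    (fun i => absolutelyContinuous_sum_weightMeasure hlam hsum (hσ i))
    (fun i => weightMeasure_absolutelyContinuous hlam hsum (hσ i))
    (fun j => absolutelyContinuous_sum_weightMeasure hlam hsum (hσ' j))
    (fun j => weightMeasure_absolutelyContinuous hlam hsum (hσ' j))

end DirectSum

section Equivalence

variable {X : Type*} [MeasurableSpace X] {μ : Measure X} [IsFiniteMeasure μ]
  {H : Type*} [NormedAddCommGroup H] [InnerProductSpace ℂ H] [CompleteSpace H]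
  {Φ : (X →ₘ[μ] Circle) →* unitary (H →L[ℂ] H)}
  {lam : (κ : Weight) → ℕ+ → Measure (Fin κ.len → X)} {K : Set ℤ}

theorem DLCondition.orthogonalityRelations (h : DLCondition K Φ) (hlam : IsSoleckiFamily μ lam)
    (hsum : IsDirectSumOfMultiplications Φ lam) : OrthogonalityRelations K lam := by
  obtain ⟨G, -, hG, hDL⟩ := h
  obtain ⟨f, hf⟩ := hG.nonempty
  intro l l' κ κ' r k k' hl hl' hk hk' hkk' hr
  choose σ hσ using exists_isMaximalSpectralType_zpow hlam hsum f
  have hconv := hDL f hf l l' k k' hl hl' hk hk' hkk' _ _ (fun i => hσ (k i)) fun j => hσ (k' j)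
  exact mutuallySingular_map_perm_of_map_evalPow hr f.measurable
    ((mutuallySingular_convolution_isMaximalSpectralType_iff hlam hsum (fun i => hσ (k i))
      fun j => hσ (k' j)).1 hconv κ κ')

theorem OrthogonalityRelations.eventually_residual [MeasurableSpace.CountablyGenerated X]
    [MeasurableSpace.SeparatesPoints X] [NullSingletonClass μ] (h : OrthogonalityRelations K lam)
    (hK : 0 ∉ K) (hlam : IsSoleckiFamily μ lam) :
    ∀ᶠ f : X →ₘ[μ] Circle in residual (X →ₘ[μ] Circle),
      ∀ (l l' : ℕ) (k : Fin l → ℤ) (k' : Fin l' → ℤ) (κ : Fin l → Weight) (κ' : Fin l' → Weight),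
        0 < l → 0 < l' → (∀ i, k i ∈ K) → (∀ j, k' j ∈ K) → ¬ IsRearrangement k k' →
        (prodMeasure lam κ).map (evalPow f (concat k κ)) ⟂ₘ
          (prodMeasure lam κ').map (evalPow f (concat k' κ')) := by
  have := measurableEq_of_separatesPoints X
  have hfin {l : ℕ} (κ : Fin l → Weight) :=
    isFiniteMeasure_prodMeasure (fun κ => hlam.finite κ 1) κ
  have hne {l : ℕ} {k : Fin l → ℤ} (hk : ∀ i, k i ∈ K) (κ : Fin l → Weight)
      (p : ConcatIndex κ) : concat k κ p ≠ 0 :=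
    mul_ne_zero (ne_of_mem_of_not_mem (hk p.1) hK) ((κ p.1).entry_ne_zero p.2)
  simp only [eventually_countable_forall]
  intro l l' k k' κ κ' hl hl' hk hk' hkk'
  exact eventually_residual_mutuallySingular (hne hk κ) (hne hk' κ')
    (prodMeasure_marginal hlam κ) (prodMeasure_marginal hlam κ')
    (fun _ _ => prodMeasure_diagonal hlam κ) (fun _ _ => prodMeasure_diagonal hlam κ')
    fun r hr => h l l' κ κ' r k k' hl hl' hk hk' hkk' hr

theorem OrthogonalityRelations.dlCondition [MeasurableSpace.CountablyGenerated X]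
    [MeasurableSpace.SeparatesPoints X] [NullSingletonClass μ] (h : OrthogonalityRelations K lam)
    (hK : 0 ∉ K) (hlam : IsSoleckiFamily μ lam) (hsum : IsDirectSumOfMultiplications Φ lam) :
    DLCondition K Φ := by
  obtain ⟨G, hGs, hG, hGd⟩ := mem_residual.1 (h.eventually_residual hK hlam)
  refine ⟨G, hG, hGd, fun f hf l l' k k' hl hl' hk hk' hkk' σ σ' hσ hσ' => ?_⟩
  exact (mutuallySingular_convolution_isMaximalSpectralType_iff hlam hsum hσ hσ').2
    fun κ κ' => hGs hf l l' k k' κ κ' hl hl' hk hk' hkk'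

end Equivalence

end SpectralDL

theorem theorem4p5_general {K : Set ℤ} (hK : 0 ∉ K) {X : Type*} [MeasurableSpace X]
    [MeasurableSpace.CountablyGenerated X] [MeasurableSpace.SeparatesPoints X]
    {μ : Measure X} [IsFiniteMeasure μ] [NullSingletonClass μ]
    {H : Type*} [NormedAddCommGroup H] [InnerProductSpace ℂ H] [CompleteSpace H]
    {Φ : (X →ₘ[μ] Circle) →* unitary (H →L[ℂ] H)}
    {lam : (κ : SpectralDL.Weight) → ℕ+ → Measure (Fin κ.len → X)}
    (hlam : SpectralDL.IsSoleckiFamily μ lam)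
    (hsum : SpectralDL.IsDirectSumOfMultiplications Φ lam) :
    SpectralDL.DLCondition K Φ ↔ SpectralDL.OrthogonalityRelations K lam :=
  ⟨fun h => h.orthogonalityRelations hlam hsum, fun h => h.dlCondition hK hlam hsum⟩

theorem theorem4p5 {X : Type*} [MeasurableSpace X] [StandardBorelSpace X]
    (μ : Measure X) [IsProbabilityMeasure μ] [NullSingletonClass μ]
    {H : Type*} [NormedAddCommGroup H] [InnerProductSpace ℂ H] [CompleteSpace H]
    [TopologicalSpace.SeparableSpace H]
    (Φ : (X →ₘ[μ] Circle) →* unitary (H →L[ℂ] H)) (hΦ : SpectralDL.StronglyContinuous Φ)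
    (lam : (κ : SpectralDL.Weight) → ℕ+ → Measure (Fin κ.len → X))
    (hlam : SpectralDL.IsSoleckiFamily μ lam)
    (hsum : SpectralDL.IsDirectSumOfMultiplications Φ lam) :
    (SpectralDL.DLCondition {k : ℤ | 0 < k} Φ ↔
        SpectralDL.OrthogonalityRelations {k : ℤ | 0 < k} lam) ∧
      (SpectralDL.DLCondition {k : ℤ | k ≠ 0} Φ ↔
        SpectralDL.OrthogonalityRelations {k : ℤ | k ≠ 0} lam) :=
  ⟨theorem4p5_general (by simp) hlam hsum, theorem4p5_general (by simp) hlam hsum⟩
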